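/- Let $(\Omega,\mathcal F,P)$ be a probability space, $Y$ and $\psi$ real random variables with $E|Y|<\infty$ and $E|\psi|<\infty$, $X$ a random vector in $\mathbb R^{d}$, and $D$ a random variable with values in $\{0,1\}$. Put $\widetilde Y=DY+(1-D)\psi$, let $p(X)=P(D=1\mid X)$ be the propensity score, suppose that $0<p(X)<1$ almost surely, and put $$W(X)=\frac{D}{p(X)}-\frac{1-D}{1-p(X)}.$$ Suppose that selection is conditionally exogenous, that is, $D$ and $(Y,\psi)$ are independent conditionally on $X$. Let $\mathrm H_{0X}$ denote the hypothesis that, possibly on an extension of the probability space (with $X$ lifted to it), there exist real random variables $Y',\psi'$ and a $\sigma$-algebra $\mathcal I'$ of events such that $\sigma(\psi',X)\subset\mathcal I'$, the conditional distribution of $Y'$ given $X$ is that of $Y$ given $X$, the conditional distribution of $\psi'$ given $X$ is that of $\psi$ given $X$, and $E[Y'\mid\mathcal I']=\psi'$ almost surely. Then $W(X)(y-\widetilde Y)^+$ (for every $y\in\mathbb R$) and $W(X)\widetilde Y$ are integrable, and $\mathrm H_{0X}$ holds if and only if $$E\left[W(X)(y-\widetilde Y)^+\mid X\right]\ge 0\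 \text{ almost surely, for every } y\in\mathbb R,\qquad\text{and}\qquad E\left[W(X)\widetilde Y\mid X\right]=0\ \text{ almost surely.}$$ Here $x^+=\max(0,x)$. -/

import Mathlib

open MeasureTheory ProbabilityTheory

noncomputable section

universe u

/-- The σ-algebra generated by the random variable `X`. -/
abbrev sigmaAlg {Ω E : Type*} [mE : MeasurableSpace E] (X : Ω → E) : MeasurableSpace Ω :=
  mE.comap X

/-- Conditional independence of the random elements `U` and `V` given `X` on an arbitrary
probability space: `P(U ∈ A, V ∈ B | X) = P(U ∈ A | X) P(V ∈ B | X)` almost surely, for all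
measurable `A`, `B`. (Mathlib's `CondIndepFun` demands a standard Borel sample space; on such a
space the two notions agree.) -/
def CondIndepGiven {Ω E F G : Type*} [MeasurableSpace Ω] [MeasurableSpace E] [MeasurableSpace F]
    [MeasurableSpace G] (P : Measure Ω) (U : Ω → E) (V : Ω → F) (X : Ω → G) : Prop :=
  ∀ (A : Set E) (B : Set F), MeasurableSet A → MeasurableSet B →
    P⟦U ⁻¹' A ∩ V ⁻¹' B | sigmaAlg X⟧ =ᵐ[P]
      P⟦U ⁻¹' A | sigmaAlg X⟧ * P⟦V ⁻¹' B | sigmaAlg X⟧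

/-- The hypothesis that rational expectations can be rationalized given the covariates `X`:
there are random variables `Y'`, `ψ'` and a σ-algebra `𝓘'` with `σ(ψ', X) ⊆ 𝓘'`,
`Y' | X ∼ Y | X`, `ψ' | X ∼ ψ | X` and `E[Y' | 𝓘'] = ψ'`.
As usual for such existence claims, `(Y', ψ')` may live on an extension `π : Ω' → Ω` of the
probability space, on which the covariates are `X ∘ π`. -/
def H0X {Ω : Type u} [MeasurableSpace Ω] {d : ℕ} (P : Measure Ω) [IsProbabilityMeasure P]
    (Y ψ : Ω → ℝ) (X : Ω → Fin d → ℝ) : Prop :=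
  ∃ (Ω' : Type u) (mΩ' : MeasurableSpace Ω') (P' : Measure Ω') (_ : IsProbabilityMeasure P')
    (π : Ω' → Ω) (Y' ψ' : Ω' → ℝ),
    MeasurePreserving π P' P ∧ Measurable Y' ∧ Measurable ψ' ∧
    condDistrib Y' (X ∘ π) P' =ᵐ[P.map X] condDistrib Y X P ∧
    condDistrib ψ' (X ∘ π) P' =ᵐ[P.map X] condDistrib ψ X P ∧
    ∃ 𝓘' : MeasurableSpace Ω', 𝓘' ≤ mΩ' ∧ sigmaAlg ψ' ⊔ sigmaAlg (X ∘ π) ≤ 𝓘' ∧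
      P'[Y' | 𝓘'] =ᵐ[P'] ψ'

/-- The propensity score `p(X) = E[D | X]`, as a random variable. -/
def propensity {Ω : Type*} [MeasurableSpace Ω] {d : ℕ} (P : Measure Ω) (D : Ω → ℝ)
    (X : Ω → Fin d → ℝ) : Ω → ℝ :=
  P[D | sigmaAlg X]

/-- The propensity-score weight `W(X) = D / p(X) - (1 - D) / (1 - p(X))`. -/
def propensityWeight {Ω : Type*} [MeasurableSpace Ω] {d : ℕ} (P : Measure Ω) (D : Ω → ℝ)
    (X : Ω → Fin d → ℝ) : Ω → ℝ :=
  fun ω => D ω / propensity P D X ω - (1 - D ω) / (1 - propensity P D X ω)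

/-- The observed variable `Ỹ = D Y + (1 - D) ψ`. -/
def observed {Ω : Type*} (D Y ψ : Ω → ℝ) : Ω → ℝ :=
  fun ω => D ω * Y ω + (1 - D ω) * ψ ω

end

/-! Conditional exogeneity makes inverse-propensity weighting exact: `E[W(X) h(Ỹ) | X] = E[h(Y) | X]
- E[h(ψ) | X]` for every measurable `h` with `h(Y)` and `h(ψ)` integrable
(`condExp_propensityWeight_mul`). With `h(s) = (y - s)⁺` and `h(s) = s`, the moment conditions say
that, for almost every value of `X`, the conditional law of `ψ` is below that of `Y` in the convex
order. What remains is a conditional Strassen theorem on the line.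

Necessity is conditional Jensen followed by the tower property (`H0X.conditional_convex_order`).

Sufficiency needs a martingale coupling that is measurable in the parameter, so it is built
explicitly from quantile functions (`exists_martingale_coupling`). Let `f` and `g` be the quantile
functions of `ψ` and `Y` given the parameter. Equal means give `(f - g)⁺` and `(g - f)⁺` the same
mass `M`; let `U` and `V` be the quantile functions of these two densities after normalization.
Convex order gives `U ≤ V`, hence `g(U) < f(U) ≤ f(V) < g(V)`. So `f(U)` and `f(V)` can both be
split, with the right barycentre, between `g(U)` and `g(V)`; where `f = g` nothing moves. Both
splits send the same mass `M dt / (g(V) - g(U))` across, so the exchange leaves the uniform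
distribution of the positions, and with it the law of the target, unchanged. -/

noncomputable section

/-! ### Quantile functions of kernels -/

/-- The uniform distribution on the unit interval, as a measure on `ℝ`. -/
abbrev unitUniform : Measure ℝ := volume.restrict (Set.Ioo 0 1)

instance : IsProbabilityMeasure unitUniform := ⟨by simp⟩

/-- The quantile function of the measures `κ x`, as a function of `(x, u)`; it is `0` when `κ x` is
not a probability measure or `u ∉ (0, 1)`. -/
def kernelQuantile {E : Type*} [MeasurableSpace E] (κ : Kernel E ℝ) (z : E × ℝ) : ℝ :=
  open Classical in
  if κ z.1 Set.univ = 1 ∧ z.2 ∈ Set.Ioo (0 : ℝ) 1 then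
    sInf {r | z.2 ≤ (κ z.1).real (Set.Iic r)} else 0

section Quantile

variable {E : Type*} [MeasurableSpace E] {κ η : Kernel E ℝ} {x : E}

/-- Right-continuity of the distribution function makes the infimum attained. The restriction to `0
< u < 1` keeps the set in the infimum nonempty and bounded below. -/
lemma kernelQuantile_le_iff (hx : κ x Set.univ = 1) {u : ℝ} (hu : u ∈ Set.Ioo (0 : ℝ) 1) (r : ℝ) :
    kernelQuantile κ (x, u) ≤ r ↔ u ≤ (κ x).real (Set.Iic r) := by
  have : IsProbabilityMeasure (κ x) := ⟨hx⟩
  rw [kernelQuantile, if_pos ⟨hx, hu⟩]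
  simp only [← cdf_eq_real]
  have hne : {r | u ≤ cdf (κ x) r}.Nonempty :=
    ((tendsto_cdf_atTop (κ x)).eventually_const_le hu.2).exists
  have hbdd : BddBelow {r | u ≤ cdf (κ x) r} := by
    obtain ⟨b, hb⟩ := ((tendsto_cdf_atBot (κ x)).eventually_lt_const hu.1).exists
    refine ⟨b, fun r hr => ?_⟩
    by_contra! h
    exact absurd (hr.trans (monotone_cdf (κ x) h.le)) (not_le.2 hb)
  constructor
  · intro h
    have hev : ∀ s, r < s → u ≤ cdf (κ x) s := fun s hs => by
      obtain ⟨t, ht, hts⟩ := exists_lt_of_csInf_lt hne (h.trans_lt hs)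
      exact le_trans ht (monotone_cdf _ hts.le)
    have hc := ((cdf (κ x)).right_continuous r).mono_left
      (nhdsWithin_mono r Set.Ioi_subset_Ici_self)
    exact ge_of_tendsto hc (Filter.eventually_of_mem self_mem_nhdsWithin hev)
  · exact fun h => csInf_le hbdd h

lemma measurable_kernelQuantile (κ : Kernel E ℝ) : Measurable (kernelQuantile κ) := by
  refine measurable_of_Iic fun r => ?_
  have hS : MeasurableSet {z : E × ℝ | κ z.1 Set.univ = 1 ∧ z.2 ∈ Set.Ioo (0 : ℝ) 1} :=
    (measurableSet_eq_fun ((κ.measurable_coe .univ).comp measurable_fst) measurable_const).inter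
      (measurable_snd measurableSet_Ioo)
  have hT : MeasurableSet {z : E × ℝ | z.2 ≤ (κ z.1).real (Set.Iic r)} :=
    measurableSet_le measurable_snd
      ((κ.measurable_coe measurableSet_Iic).ennreal_toReal.comp measurable_fst)
  -- The last piece comes from the default value `0`, which lies in `Iic r` exactly when `0 ≤ r`.
  have : kernelQuantile κ ⁻¹' Set.Iic r =
      ({z : E × ℝ | κ z.1 Set.univ = 1 ∧ z.2 ∈ Set.Ioo (0 : ℝ) 1} ∩
        {z | z.2 ≤ (κ z.1).real (Set.Iic r)}) ∪
      ({z : E × ℝ | κ z.1 Set.univ = 1 ∧ z.2 ∈ Set.Ioo (0 : ℝ) 1}ᶜ ∩ {_z | 0 ≤ r}) := by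
    ext ⟨x, u⟩
    by_cases h : κ x Set.univ = 1 ∧ u ∈ Set.Ioo (0 : ℝ) 1
    · have := kernelQuantile_le_iff h.1 h.2 r
      simp only [Set.mem_preimage, Set.mem_Iic, this, Set.mem_union, Set.mem_inter_iff,
        Set.mem_ofPred_eq, Set.mem_compl_iff, h, not_true, false_and, or_false, true_and]
    · simp only [Set.mem_preimage, Set.mem_Iic, kernelQuantile, Set.mem_union, Set.mem_inter_iff,
        Set.mem_ofPred_eq, Set.mem_compl_iff, h, not_false_eq_true, false_and, false_or,
        true_and, if_false]
  rw [this]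
  exact (hS.inter hT).union (hS.compl.inter (MeasurableSet.const _))

lemma map_kernelQuantile (hx : κ x Set.univ = 1) :
    unitUniform.map (fun u => kernelQuantile κ (x, u)) = κ x := by
  have : IsProbabilityMeasure (κ x) := ⟨hx⟩
  have hm : Measurable fun u => kernelQuantile κ (x, u) :=
    (measurable_kernelQuantile κ).comp measurable_prodMk_left
  have := Measure.isProbabilityMeasure_map (μ := unitUniform) hm.aemeasurable
  refine Measure.ext_of_Iic _ _ fun r => ?_
  rw [Measure.map_apply hm measurableSet_Iic, Measure.restrict_apply (hm measurableSet_Iic)]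
  have h1 : (κ x).real (Set.Iic r) ≤ 1 := measureReal_le_one
  have : (fun u => kernelQuantile κ (x, u)) ⁻¹' Set.Iic r ∩ Set.Ioo 0 1 =
      Set.Ioc 0 ((κ x).real (Set.Iic r)) ∩ Set.Iio 1 := by
    ext u
    by_cases hu : u ∈ Set.Ioo (0 : ℝ) 1
    · have := kernelQuantile_le_iff hx hu r
      simp only [Set.mem_inter_iff, Set.mem_preimage, Set.mem_Iic, this, hu, Set.mem_Ioc,
        Set.mem_Iio, hu.1, hu.2, true_and, and_true]
    · simp only [Set.mem_inter_iff, hu, and_false, Set.mem_Ioc, Set.mem_Iio, false_iff]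
      exact fun h => hu ⟨h.1.1, h.2⟩
  rw [this]
  -- The two sets differ at most in the endpoint `1`, and only if the distribution function already
  -- equals `1` at `r`.
  have hae : (Set.Ioc 0 ((κ x).real (Set.Iic r)) ∩ Set.Iio 1 : Set ℝ) =ᵐ[volume]
      Set.Ioc 0 ((κ x).real (Set.Iic r)) := by
    have : (Set.Ioc 0 ((κ x).real (Set.Iic r)) : Set ℝ) =
        Set.Ioc 0 ((κ x).real (Set.Iic r)) ∩ Set.Iic 1 :=
      (Set.inter_eq_left.2 fun u hu => hu.2.trans h1).symm
    conv_rhs => rw [this]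
    exact (ae_eq_refl _).inter Iio_ae_eq_Iic
  rw [measure_congr hae, Real.volume_Ioc, sub_zero, ofReal_measureReal]

lemma monotoneOn_kernelQuantile (hx : κ x Set.univ = 1) :
    MonotoneOn (fun u => kernelQuantile κ (x, u)) (Set.Ioo 0 1) := fun u hu v hv huv => by
  refine (kernelQuantile_le_iff hx hu _).2 (huv.trans ?_)
  exact (kernelQuantile_le_iff hx hv _).1 le_rfl

lemma kernelQuantile_le_kernelQuantile (hκ : κ x Set.univ = 1) (hη : η x Set.univ = 1)
    (h : ∀ r, (η x).real (Set.Iic r) ≤ (κ x).real (Set.Iic r)) {u : ℝ}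
    (hu : u ∈ Set.Ioo (0 : ℝ) 1) : kernelQuantile κ (x, u) ≤ kernelQuantile η (x, u) := by
  refine (kernelQuantile_le_iff hκ hu _).2 (le_trans ?_ (h _))
  exact (kernelQuantile_le_iff hη hu _).1 le_rfl

end Quantile

end

/-! ### Convex order through quantile functions, and the gaps between them -/

noncomputable section

open scoped ENNReal

/-- Two quantile functions `a`, `b` on `(0, 1)` in convex order: they have the same mean, and the
integrals of `a` over initial segments dominate those of `b`. -/
structure QuantileOrder (a b : ℝ → ℝ) : Prop where
  mono_left : MonotoneOn a (Set.Ioo 0 1)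
  mono_right : MonotoneOn b (Set.Ioo 0 1)
  integrable_left : Integrable a unitUniform
  integrable_right : Integrable b unitUniform
  integral_eq : ∫ u, a u ∂unitUniform = ∫ u, b u ∂unitUniform
  setIntegral_le : ∀ r, ∫ u in Set.Iic r, b u ∂unitUniform ≤ ∫ u in Set.Iic r, a u ∂unitUniform

lemma ae_unitUniform_mem : ∀ᵐ u ∂unitUniform, u ∈ Set.Ioo (0 : ℝ) 1 :=
  ae_restrict_mem measurableSet_Ioo

/-- Monotone functions on the unit interval whose put prices are ordered are in convex order. -/
lemma QuantileOrder.of_integral_max_le {a b : ℝ → ℝ} (ha : MonotoneOn a (Set.Ioo 0 1))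
    (hb : MonotoneOn b (Set.Ioo 0 1)) (hai : Integrable a unitUniform)
    (hbi : Integrable b unitUniform) (heq : ∫ u, a u ∂unitUniform = ∫ u, b u ∂unitUniform)
    (hle : ∀ y, ∫ u, max 0 (y - a u) ∂unitUniform ≤ ∫ u, max 0 (y - b u) ∂unitUniform) :
    QuantileOrder a b := by
  refine ⟨ha, hb, hai, hbi, heq, fun r => ?_⟩
  rcases le_or_gt r 0 with hr | hr
  · have h0 : unitUniform.restrict (Set.Iic r) = 0 := by
      rw [Measure.restrict_eq_zero, Measure.restrict_apply measurableSet_Iic]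
      have : Set.Iic r ∩ Set.Ioo 0 1 = ∅ := by
        ext u
        simp only [Set.mem_inter_iff, Set.mem_Iic, Set.mem_Ioo, Set.mem_empty_iff_false, iff_false]
        rintro ⟨h1, h2, -⟩
        linarith
      simp [this]
    rw [h0]; simp
  rcases le_or_gt 1 r with hr1 | hr1
  · have h1 : unitUniform.restrict (Set.Iic r) = unitUniform := by
      refine Measure.restrict_eq_self_of_ae_mem ?_
      filter_upwards [ae_unitUniform_mem] with u hu using hu.2.le.trans hr1
    rw [h1, heq]
  have hrm : r ∈ Set.Ioo (0 : ℝ) 1 := ⟨hr, hr1⟩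
  -- With this strike, monotonicity of `b` makes `(y - b)⁺` equal to `y - b` on `u ≤ r` and to zero
  -- beyond. For `a`, the positive part only bounds the integral of `y - a` over `u ≤ r` from above,
  -- which is the direction needed.
  set y := b r
  have hya : Integrable (fun u => y - a u) unitUniform := (integrable_const y).sub hai
  have hyb : Integrable (fun u => y - b u) unitUniform := (integrable_const y).sub hbi
  have hmax : Integrable (fun u => max 0 (y - a u)) unitUniform := hya.pos_part.congr
    (Filter.Eventually.of_forall fun u => max_comm _ _)
  have h1 : ∫ u in Set.Iic r, (y - a u) ∂unitUniform ≤ ∫ u, max 0 (y - a u) ∂unitUniform :=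
    (setIntegral_mono hya.integrableOn hmax.integrableOn fun u => le_max_right _ _).trans
      (setIntegral_le_integral hmax (Filter.Eventually.of_forall fun u => le_max_left _ _))
  have h2 : ∫ u, max 0 (y - b u) ∂unitUniform = ∫ u in Set.Iic r, (y - b u) ∂unitUniform := by
    rw [← integral_indicator measurableSet_Iic]
    refine integral_congr_ae ?_
    filter_upwards [ae_unitUniform_mem] with u hu
    by_cases hur : u ≤ r
    · rw [Set.indicator_of_mem (by exact hur), max_eq_right (sub_nonneg.2 (hb hu hrm hur))]
    · rw [Set.indicator_of_notMem (by exact hur), max_eq_left (sub_nonpos.2 (hb hrm hu (not_le.1 hur).le))]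
  have h3 := h1.trans ((hle y).trans h2.le)
  rw [integral_sub (integrable_const y).integrableOn hai.integrableOn,
    integral_sub (integrable_const y).integrableOn hbi.integrableOn] at h3
  linarith

section Gap

variable {E : Type*} {f g : E × ℝ → ℝ} {x : E}

/-- The integral of the positive part of `f x - g x` over the unit interval. -/
def gapMass (f g : E × ℝ → ℝ) (x : E) : ℝ≥0∞ :=
  ∫⁻ u, ENNReal.ofReal (f (x, u) - g (x, u)) ∂unitUniform

lemma QuantileOrder.gapMass_ne_top
    (h : QuantileOrder (fun u => f (x, u)) (fun u => g (x, u))) : gapMass f g x ≠ ∞ := by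
  have hi : Integrable (fun u => f (x, u) - g (x, u)) unitUniform :=
    h.integrable_left.sub h.integrable_right
  exact hi.lintegral_lt_top.ne

lemma QuantileOrder.gapMass_comm_ne_top
    (h : QuantileOrder (fun u => f (x, u)) (fun u => g (x, u))) : gapMass g f x ≠ ∞ := by
  have hi : Integrable (fun u => g (x, u) - f (x, u)) unitUniform :=
    h.integrable_right.sub h.integrable_left
  exact hi.lintegral_lt_top.ne

/-- The difference of the two sides is the integral of `f - g` over the initial segment. This
inequality is what places `U` to the left of `V`. -/
lemma QuantileOrder.setLIntegral_le
    (h : QuantileOrder (fun u => f (x, u)) (fun u => g (x, u))) (r : ℝ) :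
    ∫⁻ u in Set.Iic r, ENNReal.ofReal (g (x, u) - f (x, u)) ∂unitUniform ≤
      ∫⁻ u in Set.Iic r, ENNReal.ofReal (f (x, u) - g (x, u)) ∂unitUniform := by
  have hi : Integrable (fun u => f (x, u) - g (x, u)) (unitUniform.restrict (Set.Iic r)) :=
    (h.integrable_left.sub h.integrable_right).integrableOn
  have hj : Integrable (fun u => g (x, u) - f (x, u)) (unitUniform.restrict (Set.Iic r)) :=
    (h.integrable_right.sub h.integrable_left).integrableOn
  have h1 := integral_eq_lintegral_pos_part_sub_lintegral_neg_part hi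
  simp only [neg_sub] at h1
  rw [integral_sub h.integrable_left.integrableOn h.integrable_right.integrableOn] at h1
  have h2 := h.setIntegral_le r
  rw [← ENNReal.toReal_le_toReal hj.lintegral_lt_top.ne hi.lintegral_lt_top.ne]
  linarith

/-- Positive and negative parts of a function with integral zero have equal mass. -/
lemma QuantileOrder.gapMass_comm
    (h : QuantileOrder (fun u => f (x, u)) (fun u => g (x, u))) : gapMass g f x = gapMass f g x := by
  have hi : Integrable (fun u => f (x, u) - g (x, u)) unitUniform :=
    h.integrable_left.sub h.integrable_right
  have h1 := integral_eq_lintegral_pos_part_sub_lintegral_neg_part hi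
  simp only [neg_sub] at h1
  rw [integral_sub h.integrable_left h.integrable_right, h.integral_eq, sub_self] at h1
  refine (ENNReal.toReal_eq_toReal_iff' h.gapMass_comm_ne_top h.gapMass_ne_top).1 ?_
  unfold gapMass
  linarith

variable [MeasurableSpace E]

/-- The normalized positive part of `f x - g x`, as a kernel. -/
def gapKernel (f g : E × ℝ → ℝ) : Kernel E ℝ :=
  Kernel.withDensity (Kernel.const E unitUniform)
    (fun x u => (gapMass f g x)⁻¹ * ENNReal.ofReal (f (x, u) - g (x, u)))

/-- The quantile function of the normalized positive part of `f x - g x`. -/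
def gapQuantile (f g : E × ℝ → ℝ) : E × ℝ → ℝ := kernelQuantile (gapKernel f g)

lemma measurable_gapMass (hf : Measurable f) (hg : Measurable g) : Measurable (gapMass f g) :=
  Measurable.lintegral_prod_right' (f := fun z : E × ℝ => ENNReal.ofReal (f z - g z))
    (hf.sub hg).ennreal_ofReal

lemma measurable_gapQuantile : Measurable (gapQuantile f g) := measurable_kernelQuantile _

lemma gapKernel_apply (hf : Measurable f) (hg : Measurable g) (x : E) :
    gapKernel f g x = unitUniform.withDensity
      (fun u => (gapMass f g x)⁻¹ * ENNReal.ofReal (f (x, u) - g (x, u))) := by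
  rw [gapKernel, Kernel.withDensity_apply, Kernel.const_apply]
  exact (((measurable_gapMass hf hg).comp measurable_fst).inv).mul (hf.sub hg).ennreal_ofReal

lemma gapKernel_apply_set (hf : Measurable f) (hg : Measurable g) (x : E) {s : Set ℝ}
    (hs : MeasurableSet s) : gapKernel f g x s = (gapMass f g x)⁻¹ *
      ∫⁻ u in s, ENNReal.ofReal (f (x, u) - g (x, u)) ∂unitUniform := by
  have hm : Measurable fun u => ENNReal.ofReal (f (x, u) - g (x, u)) := by fun_prop
  rw [gapKernel_apply hf hg, withDensity_apply _ hs, lintegral_const_mul _ hm]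

lemma gapKernel_univ (hf : Measurable f) (hg : Measurable g) (h0 : gapMass f g x ≠ 0)
    (htop : gapMass f g x ≠ ∞) : gapKernel f g x Set.univ = 1 := by
  rw [gapKernel_apply_set hf hg x .univ, Measure.restrict_univ]
  exact ENNReal.inv_mul_cancel h0 htop

/-- Change of variables for the gap quantile. -/
lemma gapMass_mul_lintegral_gapQuantile (hf : Measurable f) (hg : Measurable g)
    (htop : gapMass f g x ≠ ∞) {h : ℝ → ℝ≥0∞} (hh : Measurable h) :
    gapMass f g x * ∫⁻ t, h (gapQuantile f g (x, t)) ∂unitUniform =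
      ∫⁻ u, ENNReal.ofReal (f (x, u) - g (x, u)) * h u ∂unitUniform := by
  have hm : Measurable fun u => ENNReal.ofReal (f (x, u) - g (x, u)) := by fun_prop
  by_cases h0 : gapMass f g x = 0
  · rw [h0, zero_mul, eq_comm, lintegral_eq_zero_iff (by fun_prop)]
    filter_upwards [(lintegral_eq_zero_iff hm).1 h0] with u hu
    simp only [Pi.zero_apply] at hu ⊢
    rw [hu, zero_mul]
  · have hq : Measurable fun t => gapQuantile f g (x, t) :=
      measurable_gapQuantile.comp measurable_prodMk_left
    rw [← lintegral_map hh hq]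
    unfold gapQuantile
    rw [map_kernelQuantile (gapKernel_univ hf hg h0 htop), gapKernel_apply hf hg,
      lintegral_withDensity_eq_lintegral_mul _ (hm.const_mul _) hh]
    simp only [Pi.mul_apply, mul_assoc]
    rw [lintegral_const_mul _ (by fun_prop), ← mul_assoc, ENNReal.mul_inv_cancel h0 htop, one_mul]

/-- The law of the gap quantile has a density proportional to `(f - g)⁺`, so it gives no mass to the
positions where `f ≤ g`. -/
lemma ae_lt_gapQuantile (hf : Measurable f) (hg : Measurable g)
    (h0 : gapMass f g x ≠ 0) (htop : gapMass f g x ≠ ∞) :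
    ∀ᵐ t ∂unitUniform, gapQuantile f g (x, t) ∈ Set.Ioo (0 : ℝ) 1 ∧
      g (x, gapQuantile f g (x, t)) < f (x, gapQuantile f g (x, t)) := by
  have hfx : Measurable fun u => f (x, u) := hf.comp measurable_prodMk_left
  have hgx : Measurable fun u => g (x, u) := hg.comp measurable_prodMk_left
  set s : Set ℝ := {u | u ∈ Set.Ioo (0 : ℝ) 1 ∧ g (x, u) < f (x, u)}
  have hs : MeasurableSet s := measurableSet_Ioo.inter (measurableSet_lt hgx hfx)
  have hh : Measurable (sᶜ.indicator (1 : ℝ → ℝ≥0∞)) := measurable_one.indicator hs.compl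
  have key := gapMass_mul_lintegral_gapQuantile hf hg htop hh
  have hz : ∫⁻ u, ENNReal.ofReal (f (x, u) - g (x, u)) * sᶜ.indicator 1 u ∂unitUniform = 0 := by
    rw [lintegral_eq_zero_iff (by fun_prop)]
    filter_upwards [ae_unitUniform_mem] with u hu
    by_cases hlt : g (x, u) < f (x, u)
    · rw [Set.indicator_of_notMem (Set.notMem_compl_iff.2 (show u ∈ s from ⟨hu, hlt⟩)), mul_zero, Pi.zero_apply]
    · rw [ENNReal.ofReal_of_nonpos (by linarith), zero_mul, Pi.zero_apply]
  have hq : Measurable fun t => sᶜ.indicator (1 : ℝ → ℝ≥0∞) (gapQuantile f g (x, t)) :=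
    hh.comp (measurable_gapQuantile.comp measurable_prodMk_left)
  rw [hz, mul_eq_zero, or_iff_right h0, lintegral_eq_zero_iff hq] at key
  filter_upwards [key] with t ht
  by_contra hc
  rw [Set.indicator_of_mem (show gapQuantile f g (x, t) ∈ sᶜ from hc)] at ht
  exact one_ne_zero ht

/-- The exchange position: `g (U t) < f (U t) ≤ f (V t) < g (V t)`, where `U` and `V` are the
quantile functions of the positive and the negative gap. -/
def IsExchange (f g : E × ℝ → ℝ) (z : E × ℝ) : Prop :=
  g (z.1, gapQuantile f g z) < f (z.1, gapQuantile f g z) ∧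
  f (z.1, gapQuantile f g z) ≤ f (z.1, gapQuantile g f z) ∧
  f (z.1, gapQuantile g f z) < g (z.1, gapQuantile g f z)

/-- The distribution function of the normalized positive gap dominates that of the negative gap, so
their quantiles satisfy `U ≤ V`, and `f` is monotone. -/
lemma QuantileOrder.ae_isExchange (hf : Measurable f) (hg : Measurable g)
    (h : QuantileOrder (fun u => f (x, u)) (fun u => g (x, u)))
    (h0 : gapMass f g x ≠ 0) :
    ∀ᵐ t ∂unitUniform, IsExchange f g (x, t) := by
  have h0' : gapMass g f x ≠ 0 := h.gapMass_comm ▸ h0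
  filter_upwards [ae_lt_gapQuantile hf hg h0 h.gapMass_ne_top,
    ae_lt_gapQuantile hg hf h0' h.gapMass_comm_ne_top, ae_unitUniform_mem] with t h1 h2 ht
  refine ⟨h1.2, h.mono_left h1.1 h2.1 ?_, h2.2⟩
  refine kernelQuantile_le_kernelQuantile (gapKernel_univ hf hg h0 h.gapMass_ne_top)
    (gapKernel_univ hg hf h0' h.gapMass_comm_ne_top) (fun r => ?_) ht
  have h3 : gapKernel g f x (Set.Iic r) ≤ gapKernel f g x (Set.Iic r) := by
    rw [gapKernel_apply_set hf hg x measurableSet_Iic,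
      gapKernel_apply_set hg hf x measurableSet_Iic, h.gapMass_comm]
    exact mul_le_mul_right (h.setLIntegral_le r) _
  refine ENNReal.toReal_mono (ne_top_of_le_ne_top ENNReal.one_ne_top ?_) h3
  rw [← gapKernel_univ hf hg h0 h.gapMass_ne_top]
  exact measure_mono (Set.subset_univ _)

end Gap

end

/-! ### The exchange: weights and coupling -/

noncomputable section

open scoped ENNReal

section Exchange

variable {E : Type*} [MeasurableSpace E] {f g : E × ℝ → ℝ} {x : E}

/-- The value of `k x` at the gap quantile of `f x - g x`. -/
def atGap (f g k : E × ℝ → ℝ) (z : E × ℝ) : ℝ := k (z.1, gapQuantile f g z)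

lemma measurable_atGap {k : E × ℝ → ℝ} (hk : Measurable k) : Measurable (atGap f g k) :=
  hk.comp (measurable_fst.prodMk measurable_gapQuantile)

/-- The mass moved between the two positions of an exchange. -/
def crossWeight (f g : E × ℝ → ℝ) (z : E × ℝ) : ℝ≥0∞ :=
  gapMass f g z.1 * ENNReal.ofReal (1 / (atGap g f g z - atGap f g g z))

/-- The mass staying at the lower position of an exchange. -/
def lowWeight (f g : E × ℝ → ℝ) (z : E × ℝ) : ℝ≥0∞ :=
  gapMass f g z.1 * ENNReal.ofReal ((atGap g f g z - atGap f g f z) /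
    ((atGap g f g z - atGap f g g z) * (atGap f g f z - atGap f g g z)))

/-- The mass staying at the upper position of an exchange. -/
def highWeight (f g : E × ℝ → ℝ) (z : E × ℝ) : ℝ≥0∞ :=
  gapMass f g z.1 * ENNReal.ofReal ((atGap g f f z - atGap f g g z) /
    ((atGap g f g z - atGap f g g z) * (atGap g f g z - atGap g f f z)))

lemma measurable_crossWeight (hf : Measurable f) (hg : Measurable g) :
    Measurable (crossWeight f g) := by
  have h1 : Measurable (atGap g f g) := measurable_atGap hg
  have h2 : Measurable (atGap f g g) := measurable_atGap hg
  have h3 : Measurable fun z : E × ℝ => gapMass f g z.1 :=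
    (measurable_gapMass hf hg).comp measurable_fst
  exact h3.mul (by fun_prop)

lemma measurable_lowWeight (hf : Measurable f) (hg : Measurable g) :
    Measurable (lowWeight f g) := by
  have h1 : Measurable (atGap g f g) := measurable_atGap hg
  have h2 : Measurable (atGap f g g) := measurable_atGap hg
  have h3 : Measurable fun z : E × ℝ => gapMass f g z.1 :=
    (measurable_gapMass hf hg).comp measurable_fst
  have h4 : Measurable (atGap f g f) := measurable_atGap hf
  exact h3.mul (by fun_prop)

lemma measurable_highWeight (hf : Measurable f) (hg : Measurable g) :
    Measurable (highWeight f g) := by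
  have h1 : Measurable (atGap g f g) := measurable_atGap hg
  have h2 : Measurable (atGap f g g) := measurable_atGap hg
  have h3 : Measurable fun z : E × ℝ => gapMass f g z.1 :=
    (measurable_gapMass hf hg).comp measurable_fst
  have h4 : Measurable (atGap g f f) := measurable_atGap hf
  exact h3.mul (by fun_prop)

/-- The total mass leaving `U t` is `M / (f - g)(U t)`, the rate at which `U` sweeps out Lebesgue
measure on `{g < f}`. -/
lemma IsExchange.crossWeight_add_lowWeight {z : E × ℝ} (h : IsExchange f g z) :
    crossWeight f g z + lowWeight f g z =
      gapMass f g z.1 * ENNReal.ofReal (atGap f g f z - atGap f g g z)⁻¹ := by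
  obtain ⟨h1, h2, h3⟩ := h
  change atGap f g g z < atGap f g f z at h1
  change atGap f g f z ≤ atGap g f f z at h2
  change atGap g f f z < atGap g f g z at h3
  rw [crossWeight, lowWeight, ← mul_add, ← ENNReal.ofReal_add]
  · have : atGap g f g z - atGap f g g z ≠ 0 := by linarith
    have : atGap f g f z - atGap f g g z ≠ 0 := by linarith
    congr 2
    field_simp
    ring
  · exact div_nonneg zero_le_one (by linarith)
  · exact div_nonneg (by linarith) (mul_nonneg (by linarith) (by linarith))

lemma IsExchange.crossWeight_add_highWeight {z : E × ℝ} (h : IsExchange f g z) :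
    crossWeight f g z + highWeight f g z =
      gapMass f g z.1 * ENNReal.ofReal (atGap g f g z - atGap g f f z)⁻¹ := by
  obtain ⟨h1, h2, h3⟩ := h
  change atGap f g g z < atGap f g f z at h1
  change atGap f g f z ≤ atGap g f f z at h2
  change atGap g f f z < atGap g f g z at h3
  rw [crossWeight, highWeight, ← mul_add, ← ENNReal.ofReal_add]
  · have : atGap g f g z - atGap f g g z ≠ 0 := by linarith
    have : atGap g f g z - atGap g f f z ≠ 0 := by linarith
    congr 2
    field_simp
    ring
  · exact div_nonneg zero_le_one (by linarith)
  · exact div_nonneg (by linarith) (mul_nonneg (by linarith) (by linarith))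

/-- The factor `(f - g)⁻¹` cancels the density of the gap quantile and leaves Lebesgue measure on
`{g < f}`. -/
lemma gapMass_mul_lintegral_inv (hf : Measurable f) (hg : Measurable g)
    (htop : gapMass f g x ≠ ∞) {h : ℝ → ℝ≥0∞} (hh : Measurable h) :
    ∫⁻ t, gapMass f g x * ENNReal.ofReal (atGap f g f (x, t) - atGap f g g (x, t))⁻¹ *
      h (gapQuantile f g (x, t)) ∂unitUniform =
      ∫⁻ u in {u | g (x, u) < f (x, u)}, h u ∂unitUniform := by
  have hm : Measurable fun u => ENNReal.ofReal (f (x, u) - g (x, u))⁻¹ * h u := by fun_prop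
  have hq : Measurable fun t => gapQuantile f g (x, t) :=
    measurable_gapQuantile.comp measurable_prodMk_left
  have key := gapMass_mul_lintegral_gapQuantile hf hg htop hm
  have hm' : Measurable fun t => ENNReal.ofReal (atGap f g f (x, t) - atGap f g g (x, t))⁻¹ *
      h (gapQuantile f g (x, t)) := hm.comp hq
  simp only [mul_assoc]
  rw [lintegral_const_mul _ hm']
  refine key.trans ?_
  have hs : MeasurableSet {u | g (x, u) < f (x, u)} :=
    measurableSet_lt (by fun_prop) (by fun_prop)
  rw [← lintegral_indicator hs]
  refine lintegral_congr fun u => ?_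
  by_cases hu : g (x, u) < f (x, u)
  · rw [Set.indicator_of_mem (by exact hu), ← mul_assoc, ← ENNReal.ofReal_mul (by linarith),
      mul_inv_cancel₀ (by linarith), ENNReal.ofReal_one, one_mul]
  · rw [Set.indicator_of_notMem (by exact hu), ENNReal.ofReal_of_nonpos (by linarith), zero_mul]

/-- The exchange preserves the uniform distribution. -/
lemma QuantileOrder.lintegral_exchange (hf : Measurable f) (hg : Measurable g)
    (h : QuantileOrder (fun u => f (x, u)) (fun u => g (x, u))) {k : ℝ → ℝ≥0∞}
    (hk : Measurable k) :
    (∫⁻ u in {u | f (x, u) = g (x, u)}, k u ∂unitUniform) +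
      (∫⁻ t, (crossWeight f g (x, t) + lowWeight f g (x, t)) *
        k (gapQuantile f g (x, t)) ∂unitUniform) +
      (∫⁻ t, (crossWeight f g (x, t) + highWeight f g (x, t)) *
        k (gapQuantile g f (x, t)) ∂unitUniform) = ∫⁻ u, k u ∂unitUniform := by
  -- If the gap has no mass there is no exchange position, but then all three weights vanish because
  -- of their factor `gapMass`.
  have hex : ∀ᵐ t ∂unitUniform, gapMass f g x = 0 ∨ IsExchange f g (x, t) := by
    by_cases h0 : gapMass f g x = 0
    · exact Filter.Eventually.of_forall fun t => Or.inl h0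
    · filter_upwards [h.ae_isExchange hf hg h0] with t ht using Or.inr ht
  have h1 : ∫⁻ t, (crossWeight f g (x, t) + lowWeight f g (x, t)) *
        k (gapQuantile f g (x, t)) ∂unitUniform =
      ∫⁻ u in {u | g (x, u) < f (x, u)}, k u ∂unitUniform := by
    rw [← gapMass_mul_lintegral_inv hf hg h.gapMass_ne_top hk]
    refine lintegral_congr_ae ?_
    filter_upwards [hex] with t ht
    rcases ht with h0 | ht
    · simp [crossWeight, lowWeight, h0]
    · rw [ht.crossWeight_add_lowWeight]
  have h2 : ∫⁻ t, (crossWeight f g (x, t) + highWeight f g (x, t)) *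
        k (gapQuantile g f (x, t)) ∂unitUniform =
      ∫⁻ u in {u | f (x, u) < g (x, u)}, k u ∂unitUniform := by
    rw [← gapMass_mul_lintegral_inv hg hf h.gapMass_comm_ne_top hk]
    refine lintegral_congr_ae ?_
    filter_upwards [hex] with t ht
    rcases ht with h0 | ht
    · simp [crossWeight, highWeight, h0, h.gapMass_comm]
    · rw [ht.crossWeight_add_highWeight, h.gapMass_comm]
  have hs1 : MeasurableSet {u | g (x, u) < f (x, u)} :=
    measurableSet_lt (by fun_prop) (by fun_prop)
  have hs2 : MeasurableSet {u | f (x, u) < g (x, u)} :=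
    measurableSet_lt (by fun_prop) (by fun_prop)
  rw [h1, h2, ← lintegral_union hs1, ← lintegral_union hs2]
  · have : {u | f (x, u) = g (x, u)} ∪ {u | g (x, u) < f (x, u)} ∪ {u | f (x, u) < g (x, u)} =
        Set.univ := by
      refine Set.eq_univ_of_forall fun u => ?_
      rcases lt_trichotomy (f (x, u)) (g (x, u)) with h | h | h
      · exact Or.inr h
      · exact Or.inl (Or.inl h)
      · exact Or.inl (Or.inr h)
    rw [this, Measure.restrict_univ]
  · refine Set.disjoint_left.2 fun u hu hlt => ?_
    change f (x, u) < g (x, u) at hlt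
    rcases hu with hu | hu
    · exact hlt.ne hu
    · exact hlt.not_gt hu
  · exact Set.disjoint_left.2 fun u hu hlt => absurd (Eq.symm hu) (ne_of_lt hlt)

/-- The exchange coupling: a measure on triples (parameter, source, target) whose source and target
are distributed, given the parameter, as `f x` and `g x` under the uniform distribution. -/
def exchangeCoupling (P : Measure E) (f g : E × ℝ → ℝ) : Measure (E × ℝ × ℝ) :=
  ((P.prod unitUniform).restrict {z | f z = g z}).map (fun z => (z.1, f z, g z)) +
  (((P.prod unitUniform).withDensity (crossWeight f g)).map
      (fun z => (z.1, atGap f g f z, atGap g f g z)) +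
    ((P.prod unitUniform).withDensity (lowWeight f g)).map
      (fun z => (z.1, atGap f g f z, atGap f g g z))) +
  (((P.prod unitUniform).withDensity (crossWeight f g)).map
      (fun z => (z.1, atGap g f f z, atGap f g g z)) +
    ((P.prod unitUniform).withDensity (highWeight f g)).map
      (fun z => (z.1, atGap g f f z, atGap g f g z)))

lemma lintegral_map_withDensity {α β : Type*} [MeasurableSpace α] [MeasurableSpace β]
    {μ : Measure α} {w : α → ℝ≥0∞} (hw : Measurable w) {φ : α → β} (hφ : Measurable φ)
    {H : β → ℝ≥0∞} (hH : Measurable H) :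
    ∫⁻ b, H b ∂(μ.withDensity w).map φ = ∫⁻ a, w a * H (φ a) ∂μ := by
  rw [lintegral_map hH hφ, lintegral_withDensity_eq_lintegral_mul _ hw (by fun_prop)]
  rfl

lemma lintegral_exchangeCoupling (P : Measure E) (hf : Measurable f)
    (hg : Measurable g) {H : E × ℝ × ℝ → ℝ≥0∞} (hH : Measurable H) :
    ∫⁻ y, H y ∂exchangeCoupling P f g =
      (∫⁻ z in {z | f z = g z}, H (z.1, f z, g z) ∂P.prod unitUniform) +
      ((∫⁻ z, crossWeight f g z * H (z.1, atGap f g f z, atGap g f g z) ∂P.prod unitUniform) +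
        ∫⁻ z, lowWeight f g z * H (z.1, atGap f g f z, atGap f g g z) ∂P.prod unitUniform) +
      ((∫⁻ z, crossWeight f g z * H (z.1, atGap g f f z, atGap f g g z) ∂P.prod unitUniform) +
        ∫⁻ z, highWeight f g z * H (z.1, atGap g f f z, atGap g f g z) ∂P.prod unitUniform) := by
  have h1 : Measurable (atGap g f g) := measurable_atGap hg
  have h2 : Measurable (atGap f g g) := measurable_atGap hg
  have h3 : Measurable (atGap g f f) := measurable_atGap hf
  have h4 : Measurable (atGap f g f) := measurable_atGap hf
  simp only [exchangeCoupling, lintegral_add_measure]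
  rw [lintegral_map hH (by fun_prop),
    lintegral_map_withDensity (measurable_crossWeight hf hg) (by fun_prop) hH,
    lintegral_map_withDensity (measurable_crossWeight hf hg) (by fun_prop) hH,
    lintegral_map_withDensity (measurable_lowWeight hf hg) (by fun_prop) hH,
    lintegral_map_withDensity (measurable_highWeight hf hg) (by fun_prop) hH]

end Exchange

end

/-! ### Marginals and martingale property of the exchange coupling -/

noncomputable section

open scoped ENNReal

section Marginals

variable {E : Type*} [MeasurableSpace E] {P : Measure E} {f g : E × ℝ → ℝ}

lemma lintegral_exchange_prod (hf : Measurable f) (hg : Measurable g)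
    (h : ∀ᵐ x ∂P, QuantileOrder (fun u => f (x, u)) (fun u => g (x, u)))
    {k : E × ℝ → ℝ≥0∞} (hk : Measurable k) :
    (∫⁻ z in {z | f z = g z}, k z ∂P.prod unitUniform) +
      ((∫⁻ z, crossWeight f g z * k (z.1, gapQuantile f g z) ∂P.prod unitUniform) +
        ∫⁻ z, lowWeight f g z * k (z.1, gapQuantile f g z) ∂P.prod unitUniform) +
      ((∫⁻ z, crossWeight f g z * k (z.1, gapQuantile g f z) ∂P.prod unitUniform) +
        ∫⁻ z, highWeight f g z * k (z.1, gapQuantile g f z) ∂P.prod unitUniform) =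
    ∫⁻ z, k z ∂P.prod unitUniform := by
  have hc := measurable_crossWeight hf hg
  have hl := measurable_lowWeight hf hg
  have hh := measurable_highWeight hf hg
  have hq1 : Measurable fun z : E × ℝ => k (z.1, gapQuantile f g z) :=
    hk.comp (measurable_fst.prodMk measurable_gapQuantile)
  have hq2 : Measurable fun z : E × ℝ => k (z.1, gapQuantile g f z) :=
    hk.comp (measurable_fst.prodMk measurable_gapQuantile)
  have hs : MeasurableSet {z | f z = g z} := measurableSet_eq_fun hf hg
  have hki : Measurable ({z | f z = g z}.indicator k) := hk.indicator hs
  have m1 : Measurable fun z : E × ℝ =>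
    (crossWeight f g z + lowWeight f g z) * k (z.1, gapQuantile f g z) := (hc.add hl).mul hq1
  have m2 : Measurable fun z : E × ℝ =>
    (crossWeight f g z + highWeight f g z) * k (z.1, gapQuantile g f z) := (hc.add hh).mul hq2
  have m3 : Measurable fun z : E × ℝ => crossWeight f g z * k (z.1, gapQuantile f g z) :=
    hc.mul hq1
  have m4 : Measurable fun z : E × ℝ => crossWeight f g z * k (z.1, gapQuantile g f z) :=
    hc.mul hq2
  rw [← lintegral_add_left m3, ← lintegral_add_left m4,
    ← lintegral_indicator hs]
  simp only [← add_mul]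
  rw [lintegral_prod _ hki.aemeasurable, lintegral_prod _ m1.aemeasurable,
    lintegral_prod _ m2.aemeasurable, lintegral_prod _ hk.aemeasurable,
    ← lintegral_add_left (by exact hki.lintegral_prod_right'), ← lintegral_add_left
      (by exact hki.lintegral_prod_right'.add m1.lintegral_prod_right')]
  refine lintegral_congr_ae ?_
  filter_upwards [h] with x hx
  have hkx : Measurable fun u => k (x, u) := hk.comp measurable_prodMk_left
  rw [← hx.lintegral_exchange hf hg hkx, ← lintegral_indicator
    (measurableSet_eq_fun (by fun_prop) (by fun_prop))]
  rfl

lemma map_source_exchangeCoupling (hf : Measurable f) (hg : Measurable g)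
    (h : ∀ᵐ x ∂P, QuantileOrder (fun u => f (x, u)) (fun u => g (x, u))) :
    (exchangeCoupling P f g).map (fun y => (y.1, y.2.1)) =
      (P.prod unitUniform).map (fun z => (z.1, f z)) := by
  refine Measure.ext_of_lintegral _ fun H hH => ?_
  rw [lintegral_map hH (by fun_prop), lintegral_map hH (by fun_prop),
    lintegral_exchangeCoupling P hf hg (by fun_prop),
    ← lintegral_exchange_prod (k := fun z => H (z.1, f z)) hf hg h (by fun_prop)]
  rfl

/-- The two crossing terms have the same weight, so for the target they trade places: mass leaving
`U` for `g(V)` is replaced by mass from `V` arriving at `g(U)`. After this swap the sum is again the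
one in `lintegral_exchange_prod`. -/
lemma map_target_exchangeCoupling (hf : Measurable f) (hg : Measurable g)
    (h : ∀ᵐ x ∂P, QuantileOrder (fun u => f (x, u)) (fun u => g (x, u))) :
    (exchangeCoupling P f g).map (fun y => (y.1, y.2.2)) =
      (P.prod unitUniform).map (fun z => (z.1, g z)) := by
  refine Measure.ext_of_lintegral _ fun H hH => ?_
  rw [lintegral_map hH (by fun_prop), lintegral_map hH (by fun_prop),
    lintegral_exchangeCoupling P hf hg (by fun_prop),
    ← lintegral_exchange_prod (k := fun z => H (z.1, g z)) hf hg h (by fun_prop)]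
  have e1 : ∀ z, g (z.1, gapQuantile f g z) = atGap f g g z := fun _ => rfl
  have e2 : ∀ z, g (z.1, gapQuantile g f z) = atGap g f g z := fun _ => rfl
  simp only [e1, e2]
  ring

lemma ae_isExchange_prod (hf : Measurable f) (hg : Measurable g)
    (h : ∀ᵐ x ∂P, QuantileOrder (fun u => f (x, u)) (fun u => g (x, u))) :
    ∀ᵐ z ∂P.prod unitUniform,
      gapMass f g z.1 ≠ ∞ ∧ (gapMass f g z.1 = 0 ∨ IsExchange f g z) := by
  have hM : Measurable fun z : E × ℝ => gapMass f g z.1 :=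
    (measurable_gapMass hf hg).comp measurable_fst
  have h1 : Measurable (atGap g f g) := measurable_atGap hg
  have h2 : Measurable (atGap f g g) := measurable_atGap hg
  have h3 : Measurable (atGap g f f) := measurable_atGap hf
  have h4 : Measurable (atGap f g f) := measurable_atGap hf
  have hs : MeasurableSet {z : E × ℝ | gapMass f g z.1 ≠ ∞ ∧
      (gapMass f g z.1 = 0 ∨ IsExchange f g z)} :=
    (hM (measurableSet_singleton ∞).compl).inter ((hM (measurableSet_singleton 0)).union
      ((measurableSet_lt h2 h4).inter ((measurableSet_le h4 h3).inter (measurableSet_lt h3 h1))))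
  refine (Measure.ae_prod_iff_ae_ae hs).2 ?_
  filter_upwards [h] with x hx
  by_cases h0 : gapMass f g x = 0
  · exact Filter.Eventually.of_forall fun t => ⟨hx.gapMass_ne_top, Or.inl h0⟩
  · filter_upwards [hx.ae_isExchange hf hg h0] with t ht using ⟨hx.gapMass_ne_top, Or.inr ht⟩

lemma integral_map_withDensity {α β : Type*} [MeasurableSpace α] [MeasurableSpace β]
    {μ : Measure α} {w : α → ℝ≥0∞} (hw : Measurable w) (hw' : ∀ᵐ a ∂μ, w a < ∞)
    {φ : α → β} (hφ : Measurable φ) {H : β → ℝ} (hH : Measurable H) :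
    ∫ b, H b ∂(μ.withDensity w).map φ = ∫ a, (w a).toReal * H (φ a) ∂μ := by
  rw [integral_map hφ.aemeasurable hH.aestronglyMeasurable,
    integral_withDensity_eq_integral_toReal_smul hw hw']
  rfl

/-- The weights are barycentric: at each source, `f(U)` or `f(V)`, the upward and the downward
displacement cancel. The test function `k` sees only parameter and source, so it factors out of the
cancellation. -/
lemma integral_exchangeCoupling_mul_sub (hf : Measurable f) (hg : Measurable g)
    (h : ∀ᵐ x ∂P, QuantileOrder (fun u => f (x, u)) (fun u => g (x, u)))
    {k : E × ℝ → ℝ} (hk : Measurable k)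
    (hi : Integrable (fun y => k (y.1, y.2.1) * (y.2.2 - y.2.1)) (exchangeCoupling P f g)) :
    ∫ y, k (y.1, y.2.1) * (y.2.2 - y.2.1) ∂exchangeCoupling P f g = 0 := by
  have h1 : Measurable (atGap g f g) := measurable_atGap hg
  have h2 : Measurable (atGap f g g) := measurable_atGap hg
  have h3 : Measurable (atGap g f f) := measurable_atGap hf
  have h4 : Measurable (atGap f g f) := measurable_atGap hf
  have hs : MeasurableSet {z | f z = g z} := measurableSet_eq_fun hf hg
  have hae := ae_isExchange_prod hf hg h
  have hH : Measurable fun y : E × ℝ × ℝ => k (y.1, y.2.1) * (y.2.2 - y.2.1) := by fun_prop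
  have hfin : ∀ {w : E × ℝ → ℝ}, ∀ᵐ z ∂P.prod unitUniform,
      gapMass f g z.1 * ENNReal.ofReal (w z) < ∞ := fun {w} => by
    filter_upwards [hae] with z hz using ENNReal.mul_lt_top hz.1.lt_top ENNReal.ofReal_lt_top
  unfold exchangeCoupling at hi ⊢
  have hi1 := hi.left_of_add_measure
  have hi2 := hi.right_of_add_measure
  rw [integral_add_measure hi1 hi2, integral_add_measure hi1.left_of_add_measure
    hi1.right_of_add_measure, integral_add_measure hi1.right_of_add_measure.left_of_add_measure
    hi1.right_of_add_measure.right_of_add_measure,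
    integral_add_measure hi2.left_of_add_measure hi2.right_of_add_measure,
    integral_map (by fun_prop) hH.aestronglyMeasurable,
    integral_map_withDensity (measurable_crossWeight hf hg) hfin (by fun_prop) hH,
    integral_map_withDensity (measurable_crossWeight hf hg) hfin (by fun_prop) hH,
    integral_map_withDensity (measurable_lowWeight hf hg) hfin (by fun_prop) hH,
    integral_map_withDensity (measurable_highWeight hf hg) hfin (by fun_prop) hH]
  have e0 : ∫ z in {z | f z = g z}, k (z.1, f z) * (g z - f z) ∂P.prod unitUniform = 0 := by
    refine integral_eq_zero_of_ae ?_
    filter_upwards [ae_restrict_mem hs] with z hz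
    have : f z = g z := hz
    simp [this]
  have e1 : ∫ z, (crossWeight f g z).toReal * (k (z.1, atGap f g f z) *
        (atGap g f g z - atGap f g f z)) ∂P.prod unitUniform =
      -∫ z, (lowWeight f g z).toReal * (k (z.1, atGap f g f z) *
        (atGap f g g z - atGap f g f z)) ∂P.prod unitUniform := by
    rw [← integral_neg]
    refine integral_congr_ae ?_
    filter_upwards [hae] with z hz
    rcases hz.2 with h0 | ⟨o1, o2, o3⟩
    · simp [crossWeight, lowWeight, h0]
    · change atGap f g g z < atGap f g f z at o1
      change atGap f g f z ≤ atGap g f f z at o2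
      change atGap g f f z < atGap g f g z at o3
      have n1 : atGap g f g z - atGap f g g z ≠ 0 := by linarith
      have n2 : atGap f g f z - atGap f g g z ≠ 0 := by linarith
      rw [crossWeight, lowWeight, ENNReal.toReal_mul, ENNReal.toReal_mul,
        ENNReal.toReal_ofReal (div_nonneg zero_le_one (by linarith)),
        ENNReal.toReal_ofReal (div_nonneg (by linarith)
          (mul_nonneg (by linarith) (by linarith)))]
      field_simp
      ring
  have e2 : ∫ z, (crossWeight f g z).toReal * (k (z.1, atGap g f f z) *
        (atGap f g g z - atGap g f f z)) ∂P.prod unitUniform =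
      -∫ z, (highWeight f g z).toReal * (k (z.1, atGap g f f z) *
        (atGap g f g z - atGap g f f z)) ∂P.prod unitUniform := by
    rw [← integral_neg]
    refine integral_congr_ae ?_
    filter_upwards [hae] with z hz
    rcases hz.2 with h0 | ⟨o1, o2, o3⟩
    · simp [crossWeight, highWeight, h0]
    · change atGap f g g z < atGap f g f z at o1
      change atGap f g f z ≤ atGap g f f z at o2
      change atGap g f f z < atGap g f g z at o3
      have n1 : atGap g f g z - atGap f g g z ≠ 0 := by linarith
      have n2 : atGap g f g z - atGap g f f z ≠ 0 := by linarith
      rw [crossWeight, highWeight, ENNReal.toReal_mul, ENNReal.toReal_mul,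
        ENNReal.toReal_ofReal (div_nonneg zero_le_one (by linarith)),
        ENNReal.toReal_ofReal (div_nonneg (by linarith)
          (mul_nonneg (by linarith) (by linarith)))]
      field_simp
      ring
  rw [e0, e1, e2]
  ring

end Marginals

/-! ### Conditional Strassen theorem -/

section Strassen

variable {E : Type*} [MeasurableSpace E] {P : Measure E} [IsProbabilityMeasure P]

lemma map_prod_kernelQuantile (κ : Kernel E ℝ) [IsMarkovKernel κ] :
    (P.prod unitUniform).map (fun z => (z.1, kernelQuantile κ z)) = P ⊗ₘ κ := by
  have hq := measurable_kernelQuantile κ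
  refine Measure.ext_of_lintegral _ fun H hH => ?_
  rw [lintegral_map hH (by fun_prop), Measure.lintegral_compProd hH,
    lintegral_prod _ (by fun_prop)]
  refine lintegral_congr fun x => ?_
  have hHx : Measurable fun s => H (x, s) := hH.comp measurable_prodMk_left
  rw [← map_kernelQuantile (κ := κ) (x := x) measure_univ, lintegral_map hHx (by fun_prop)]

/-- Conditional Strassen theorem on the line: if the kernel `η` is almost everywhere dominated by
`κ` in convex order, there is a coupling of the two, given the parameter, which is a martingale
given the parameter. -/
theorem exists_martingale_coupling (η κ : Kernel E ℝ) [IsMarkovKernel η] [IsMarkovKernel κ]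
    (hη : Integrable (fun y => y.2) (P ⊗ₘ η)) (hκ : Integrable (fun y => y.2) (P ⊗ₘ κ))
    (hmean : ∀ᵐ x ∂P, ∫ s, s ∂η x = ∫ s, s ∂κ x)
    (hput : ∀ y : ℝ, ∀ᵐ x ∂P, ∫ s, max 0 (y - s) ∂η x ≤ ∫ s, max 0 (y - s) ∂κ x) :
    ∃ Q : Measure (E × ℝ × ℝ), IsProbabilityMeasure Q ∧
      Q.map (fun y => (y.1, y.2.1)) = P ⊗ₘ η ∧ Q.map (fun y => (y.1, y.2.2)) = P ⊗ₘ κ ∧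
      Q[fun y => y.2.2 | sigmaAlg (fun y : E × ℝ × ℝ => (y.1, y.2.1))] =ᵐ[Q] fun y => y.2.1 := by
  set f := kernelQuantile η
  set g := kernelQuantile κ
  have hf : Measurable f := measurable_kernelQuantile η
  have hg : Measurable g := measurable_kernelQuantile κ
  have hq : ∀ᵐ x ∂P, QuantileOrder (fun u => f (x, u)) (fun u => g (x, u)) := by
    have hput' : ∀ᵐ x ∂P, ∀ y : ℚ,
        ∫ s, max 0 ((y : ℝ) - s) ∂η x ≤ ∫ s, max 0 ((y : ℝ) - s) ∂κ x :=
      ae_all_iff.2 fun y => hput y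
    have hη' := ((Measure.integrable_compProd_iff hη.1).1 hη).1
    have hκ' := ((Measure.integrable_compProd_iff hκ.1).1 hκ).1
    filter_upwards [hput', hη', hκ', hmean] with x hx hηx hκx hmx
    have hfx : Measurable fun u => f (x, u) := hf.comp measurable_prodMk_left
    have hgx : Measurable fun u => g (x, u) := hg.comp measurable_prodMk_left
    have mf : unitUniform.map (fun u => f (x, u)) = η x := map_kernelQuantile measure_univ
    have mg : unitUniform.map (fun u => g (x, u)) = κ x := map_kernelQuantile measure_univ
    have hall : ∀ y : ℝ, ∫ s, max 0 (y - s) ∂η x ≤ ∫ s, max 0 (y - s) ∂κ x := by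
      -- The exceptional null set depends on `y`. Continuity of the put price in `y` extends the
      -- inequality from rational strikes to all strikes outside one null set.
      have hc : ∀ (μ : Measure ℝ) [IsProbabilityMeasure μ], Integrable (fun s => s) μ →
          Continuous fun y : ℝ => ∫ s, max 0 (y - s) ∂μ := fun μ _ hμ => by
        refine continuous_iff_continuousAt.2 fun y₀ => ?_
        refine continuousAt_of_dominated (bound := fun s => (|y₀| + 1) + |s|)
          (Filter.Eventually.of_forall fun y => by fun_prop) ?_
          ((integrable_const _).add hμ.abs)
          (Filter.Eventually.of_forall fun s => by fun_prop)
        filter_upwards [Metric.ball_mem_nhds y₀ one_pos] with y hy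
        refine Filter.Eventually.of_forall fun s => ?_
        rw [Real.norm_eq_abs, abs_of_nonneg (le_max_left _ _)]
        rw [Metric.mem_ball, Real.dist_eq, abs_lt] at hy
        refine max_le (by positivity) ?_
        linarith [le_abs_self y₀, neg_abs_le s, hy.2]
      intro y
      exact Rat.denseRange_cast.induction_on (p := fun y : ℝ =>
        ∫ s, max 0 (y - s) ∂η x ≤ ∫ s, max 0 (y - s) ∂κ x) y
        (isClosed_le (hc (η x) hηx) (hc (κ x) hκx)) hx
    refine QuantileOrder.of_integral_max_le (monotoneOn_kernelQuantile measure_univ)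
      (monotoneOn_kernelQuantile measure_univ) ?_ ?_ ?_ fun y => ?_
    · rw [← mf] at hηx
      exact hηx.comp_measurable hfx
    · rw [← mg] at hκx
      exact hκx.comp_measurable hgx
    · rw [← mf, ← mg, integral_map hfx.aemeasurable (by fun_prop),
        integral_map hgx.aemeasurable (by fun_prop)] at hmx
      exact hmx
    · have := hall y
      rw [← mf, ← mg, integral_map hfx.aemeasurable (by fun_prop),
        integral_map hgx.aemeasurable (by fun_prop)] at this
      exact this
  have hS := map_source_exchangeCoupling hf hg hq
  have hT := map_target_exchangeCoupling hf hg hq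
  rw [map_prod_kernelQuantile] at hS hT
  set Q := exchangeCoupling P f g with hQ
  have hprob : IsProbabilityMeasure Q := by
    refine ⟨?_⟩
    have : (Q.map fun y => (y.1, y.2.1)) Set.univ = 1 := by rw [hS, measure_univ]
    rwa [Measure.map_apply (by fun_prop) .univ, Set.preimage_univ] at this
  refine ⟨Q, hprob, hS, hT, ?_⟩
  have iS : Integrable (fun y : E × ℝ × ℝ => y.2.1) Q := by
    rw [← hS] at hη
    exact hη.comp_measurable (by fun_prop : Measurable fun y : E × ℝ × ℝ => (y.1, y.2.1))
  have iT : Integrable (fun y : E × ℝ × ℝ => y.2.2) Q := by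
    rw [← hT] at hκ
    exact hκ.comp_measurable (by fun_prop : Measurable fun y : E × ℝ × ℝ => (y.1, y.2.2))
  have hm : Measurable fun y : E × ℝ × ℝ => (y.1, y.2.1) := by fun_prop
  symm
  refine ae_eq_condExp_of_forall_setIntegral_eq hm.comap_le iT (fun _ _ _ => iS.integrableOn)
    ?_ ?_
  · rintro _ ⟨A, hA, rfl⟩ -
    have hk : Measurable (A.indicator (fun _ => (1 : ℝ))) := measurable_const.indicator hA
    have he : (fun y : E × ℝ × ℝ => A.indicator (fun _ => (1 : ℝ)) (y.1, y.2.1) *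
        (y.2.2 - y.2.1)) = ((fun y : E × ℝ × ℝ => (y.1, y.2.1)) ⁻¹' A).indicator
          (fun y => y.2.2 - y.2.1) := by
      ext y
      by_cases hy : (y.1, y.2.1) ∈ A
      · rw [Set.indicator_of_mem hy, Set.indicator_of_mem (by exact hy), one_mul]
      · rw [Set.indicator_of_notMem hy, Set.indicator_of_notMem (by exact hy), zero_mul]
    have hz := integral_exchangeCoupling_mul_sub (P := P) hf hg hq hk
      (by rw [he]; exact (iT.sub iS).indicator (hm hA))
    rw [he, integral_indicator (hm hA), integral_sub iT.integrableOn iS.integrableOn] at hz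
    linarith
  · have : StronglyMeasurable[sigmaAlg (fun y : E × ℝ × ℝ => (y.1, y.2.1))]
        fun y : E × ℝ × ℝ => y.2.1 :=
      (measurable_snd.comp (comap_measurable _)).stronglyMeasurable
    exact this.aestronglyMeasurable

end Strassen

end

/-! ### Inverse-propensity weighting -/

noncomputable section

open scoped ENNReal

section InverseWeighting

variable {Ω E F : Type*} [MeasurableSpace Ω] [MeasurableSpace E] [MeasurableSpace F]
  {P : Measure Ω} {X : Ω → E} {V : Ω → F} {S : Set Ω}

/-- The inverse-probability weight of the event `S`. -/
def inverseWeight (P : Measure Ω) (X : Ω → E) (S : Set Ω) : Ω → ℝ :=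
  S.indicator fun ω => ((P⟦S | sigmaAlg X⟧) ω)⁻¹

lemma measurable_inverseWeight (hX : Measurable X) (hS : MeasurableSet S) :
    Measurable (inverseWeight P X S) :=
  ((stronglyMeasurable_condExp.measurable.mono hX.comap_le le_rfl).inv).indicator hS

variable [IsProbabilityMeasure P]

/-- If the event `S` is conditionally independent of `V` given `X`, then restricting to `S` or
weighting by the conditional probability of `S` yields the same law of `(X, V)`. -/
lemma map_restrict_eq_map_withDensity_condExp (hX : Measurable X) (hV : Measurable V)
    (hS : MeasurableSet S)
    (hCI : ∀ B, MeasurableSet B → P⟦S ∩ V ⁻¹' B | sigmaAlg X⟧ =ᵐ[P]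
      P⟦S | sigmaAlg X⟧ * P⟦V ⁻¹' B | sigmaAlg X⟧) :
    (P.restrict S).map (fun ω => (X ω, V ω)) =
      (P.withDensity fun ω => ENNReal.ofReal ((P⟦S | sigmaAlg X⟧) ω)).map
        (fun ω => (X ω, V ω)) := by
  have hXV : Measurable fun ω => (X ω, V ω) := hX.prodMk hV
  set p := P⟦S | sigmaAlg X⟧ with hp
  have hp0 : 0 ≤ᵐ[P] p := condExp_nonneg (Filter.Eventually.of_forall fun ω =>
    Set.indicator_nonneg (fun _ _ => zero_le_one) ω)
  have hpi : Integrable p P := integrable_condExp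
  refine Measure.ext_prod fun {A B} hA hB => ?_
  have hXA := hX hA
  have hVB := hV hB
  rw [Measure.map_apply hXV (hA.prod hB), Measure.map_apply hXV (hA.prod hB), Set.mk_preimage_prod,
    Measure.restrict_apply (hXA.inter hVB), withDensity_apply _ (hXA.inter hVB)]
  have i1 : Integrable (p * (V ⁻¹' B).indicator fun _ => (1 : ℝ)) P := by
    refine (hpi.indicator hVB).congr (Filter.Eventually.of_forall fun ω => ?_)
    by_cases hω : ω ∈ V ⁻¹' B <;> simp [hω]
  have i2 : Integrable ((V ⁻¹' B).indicator fun _ => (1 : ℝ)) P :=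
    (integrable_const _).indicator hVB
  have i3 : Integrable ((S ∩ V ⁻¹' B).indicator fun _ => (1 : ℝ)) P :=
    (integrable_const _).indicator (hS.inter hVB)
  have hA' : MeasurableSet[sigmaAlg X] (X ⁻¹' A) := ⟨A, hA, rfl⟩
  have key : ∫ ω in X ⁻¹' A, (S ∩ V ⁻¹' B).indicator (fun _ => (1 : ℝ)) ω ∂P =
      ∫ ω in X ⁻¹' A, (p * (V ⁻¹' B).indicator fun _ => (1 : ℝ)) ω ∂P := by
    rw [← setIntegral_condExp hX.comap_le i3 hA', ← setIntegral_condExp hX.comap_le i1 hA']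
    refine integral_congr_ae (ae_restrict_of_ae ?_)
    -- Given `X`, the joint probability factors by conditional independence, and `p` can be pulled
    -- out because it is `σ(X)`-measurable.
    filter_upwards [hCI B hB, condExp_mul_of_stronglyMeasurable_left
      (stronglyMeasurable_condExp : StronglyMeasurable[sigmaAlg X] p) i1 i2] with ω h1 h2
    rw [h1, h2]
  have l1 : ∫ ω in X ⁻¹' A, (S ∩ V ⁻¹' B).indicator (fun _ => (1 : ℝ)) ω ∂P =
      P.real (X ⁻¹' A ∩ V ⁻¹' B ∩ S) := by
    rw [integral_indicator (hS.inter hVB), Measure.restrict_restrict (hS.inter hVB),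
      integral_const, smul_eq_mul, mul_one, measureReal_restrict_apply .univ, Set.univ_inter]
    congr 1
    ext ω
    simp only [Set.mem_inter_iff]
    tauto
  have l2 : ∫ ω in X ⁻¹' A, (p * (V ⁻¹' B).indicator fun _ => (1 : ℝ)) ω ∂P =
      ∫ ω in X ⁻¹' A ∩ V ⁻¹' B, p ω ∂P := by
    rw [Set.inter_comm, ← Measure.restrict_restrict hVB, ← integral_indicator hVB]
    refine integral_congr_ae (Filter.Eventually.of_forall fun ω => ?_)
    by_cases hω : ω ∈ V ⁻¹' B <;> simp [hω]
  rw [l1, l2] at key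
  rw [← ofReal_measureReal, key, ofReal_integral_eq_lintegral_ofReal hpi.integrableOn
    (ae_restrict_of_ae hp0)]

/-- Inverse-probability weighting by an event which is conditionally independent of `V` given `X`
preserves the law of `(X, V)`. -/
lemma map_withDensity_inverseWeight (hX : Measurable X) (hV : Measurable V)
    (hS : MeasurableSet S)
    (hCI : ∀ B, MeasurableSet B → P⟦S ∩ V ⁻¹' B | sigmaAlg X⟧ =ᵐ[P]
      P⟦S | sigmaAlg X⟧ * P⟦V ⁻¹' B | sigmaAlg X⟧)
    (hpos : ∀ᵐ ω ∂P, 0 < (P⟦S | sigmaAlg X⟧) ω) :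
    (P.withDensity fun ω => ENNReal.ofReal (inverseWeight P X S ω)).map (fun ω => (X ω, V ω)) =
      P.map (fun ω => (X ω, V ω)) := by
  have hXV : Measurable fun ω => (X ω, V ω) := hX.prodMk hV
  have key := map_restrict_eq_map_withDensity_condExp hX hV hS hCI
  have hw := (measurable_inverseWeight (P := P) hX hS).ennreal_ofReal
  have hpS : StronglyMeasurable[sigmaAlg X] (P⟦S | sigmaAlg X⟧) := stronglyMeasurable_condExp
  have hpm : Measurable (P⟦S | sigmaAlg X⟧) := hpS.measurable.mono hX.comap_le le_rfl
  -- Writing the conditional probability as `q(X)` turns division by it into a test function of `(X,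
  -- V)`, to which the identity of laws applies.
  obtain ⟨q, hq, hpq⟩ := hpS.exists_eq_measurable_comp
  replace hq : Measurable q := hq.measurable
  refine Measure.ext_of_lintegral _ fun H hH => ?_
  have hHX : Measurable fun ω => H (X ω, V ω) := hH.comp hXV
  set G : E × F → ℝ≥0∞ := fun y => ENNReal.ofReal (q y.1)⁻¹ * H y with hG
  have hGm : Measurable G := by fun_prop
  have hGX : Measurable fun ω => G (X ω, V ω) := hGm.comp hXV
  have e := congrArg (fun μ => ∫⁻ y, G y ∂μ) key
  rw [lintegral_map hGm hXV, lintegral_map hGm hXV,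
    lintegral_withDensity_eq_lintegral_mul _ hpm.ennreal_ofReal hGX,
    ← lintegral_indicator hS] at e
  rw [lintegral_map hH hXV, lintegral_map hH hXV,
    lintegral_withDensity_eq_lintegral_mul _ hw hHX]
  calc _ = ∫⁻ ω, S.indicator (fun ω => G (X ω, V ω)) ω ∂P := by
        refine lintegral_congr fun ω => ?_
        by_cases hω : ω ∈ S
        · simp [inverseWeight, hω, hG, hpq]
        · simp [inverseWeight, hω]
    _ = _ := e
    _ = _ := by
        refine lintegral_congr_ae ?_
        filter_upwards [hpos] with ω hω
        have : q (X ω) = (P⟦S | sigmaAlg X⟧) ω := by rw [hpq]; rfl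
        simp only [Pi.mul_apply, hG]
        rw [this, ← mul_assoc, ← ENNReal.ofReal_mul hω.le, mul_inv_cancel₀ hω.ne',
          ENNReal.ofReal_one, one_mul]

/-- Both claims are read off the equality of the weighted and unweighted laws of `(X, V)`, tested on
`h` and on `h` cut off to `X ∈ A`. -/
lemma integrable_inverseWeight_mul (hX : Measurable X) (hV : Measurable V)
    (hS : MeasurableSet S)
    (hCI : ∀ B, MeasurableSet B → P⟦S ∩ V ⁻¹' B | sigmaAlg X⟧ =ᵐ[P]
      P⟦S | sigmaAlg X⟧ * P⟦V ⁻¹' B | sigmaAlg X⟧)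
    (hpos : ∀ᵐ ω ∂P, 0 < (P⟦S | sigmaAlg X⟧) ω) {h : F → ℝ} (hh : Measurable h)
    (hi : Integrable (fun ω => h (V ω)) P) :
    Integrable (fun ω => inverseWeight P X S ω * h (V ω)) P ∧
      P[fun ω => inverseWeight P X S ω * h (V ω) | sigmaAlg X] =ᵐ[P]
        P[fun ω => h (V ω) | sigmaAlg X] := by
  have hXV : Measurable fun ω => (X ω, V ω) := hX.prodMk hV
  have key := map_withDensity_inverseWeight hX hV hS hCI hpos
  have hw := (measurable_inverseWeight (P := P) hX hS).ennreal_ofReal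
  have hwfin : ∀ᵐ ω ∂P, ENNReal.ofReal (inverseWeight P X S ω) < ∞ :=
    Filter.Eventually.of_forall fun ω => ENNReal.ofReal_lt_top
  have hwnn : ∀ᵐ ω ∂P, (ENNReal.ofReal (inverseWeight P X S ω)).toReal =
      inverseWeight P X S ω := by
    filter_upwards [hpos] with ω hω
    exact ENNReal.toReal_ofReal (Set.indicator_apply_nonneg fun _ => (inv_pos.2 hω).le)
  have hint : Integrable (fun ω => inverseWeight P X S ω * h (V ω)) P := by
    have hh2 : Measurable fun y : E × F => h y.2 := hh.comp measurable_snd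
    have h1 : Integrable (fun y : E × F => h y.2) (P.map fun ω => (X ω, V ω)) :=
      (integrable_map_measure hh2.aestronglyMeasurable hXV.aemeasurable).2 hi
    rw [← key, integrable_map_measure hh2.aestronglyMeasurable hXV.aemeasurable] at h1
    refine ((integrable_withDensity_iff_integrable_smul' hw hwfin).1 h1).congr ?_
    filter_upwards [hwnn] with ω hω
    simp only [Function.comp_apply, smul_eq_mul, hω]
  refine ⟨hint, ?_⟩
  refine (ae_eq_condExp_of_forall_setIntegral_eq hX.comap_le hi
    (fun _ _ _ => integrable_condExp.integrableOn) ?_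
    stronglyMeasurable_condExp.aestronglyMeasurable)
  rintro _ ⟨A, hA, rfl⟩ -
  rw [setIntegral_condExp hX.comap_le hint ⟨A, hA, rfl⟩]
  have hk : Measurable fun y : E × F => (A ×ˢ Set.univ).indicator (fun y => h y.2) y :=
    (hh.comp measurable_snd).indicator (hA.prod .univ)
  have e := congrArg (fun μ => ∫ y, (A ×ˢ Set.univ).indicator (fun y => h y.2) y ∂μ) key
  rw [integral_map hXV.aemeasurable hk.aestronglyMeasurable,
    integral_map hXV.aemeasurable hk.aestronglyMeasurable,
    integral_withDensity_eq_integral_toReal_smul hw hwfin] at e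
  rw [← integral_indicator (hX hA), ← integral_indicator (hX hA)]
  calc _ = _ := by
        refine integral_congr_ae ?_
        filter_upwards [hwnn] with ω hω
        rw [hω]
        by_cases hA' : X ω ∈ A <;> simp [Set.indicator, hA']
    _ = _ := e
    _ = _ := integral_congr_ae (Filter.Eventually.of_forall fun ω => by
        by_cases hA' : X ω ∈ A <;> simp [Set.indicator, hA'])

end InverseWeighting

section Propensity

variable {Ω : Type*} [MeasurableSpace Ω] {P : Measure Ω}
  {d : ℕ} {Y ψ D : Ω → ℝ} {X : Ω → Fin d → ℝ}

lemma propensity_eq (hD : ∀ ω, D ω = 0 ∨ D ω = 1) :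
    propensity P D X = P⟦D ⁻¹' {1} | sigmaAlg X⟧ := by
  have : D = (D ⁻¹' {1}).indicator fun _ => (1 : ℝ) := by
    ext ω
    rcases hD ω with h | h <;> simp [Set.indicator, h]
  rw [propensity]
  conv_lhs => rw [this]

variable [IsProbabilityMeasure P]

lemma one_sub_propensity_eq (hXm : Measurable X) (hDm : Measurable D)
    (hD : ∀ ω, D ω = 0 ∨ D ω = 1) :
    P⟦D ⁻¹' {0} | sigmaAlg X⟧ =ᵐ[P] fun ω => 1 - propensity P D X ω := by
  have : (D ⁻¹' {0}).indicator (fun _ => (1 : ℝ)) =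
      (fun _ => (1 : ℝ)) - (D ⁻¹' {1}).indicator fun _ => (1 : ℝ) := by
    ext ω
    rcases hD ω with h | h <;> simp [Set.indicator, h]
  rw [this, propensity_eq hD]
  have h1 : P[fun _ => (1 : ℝ) | sigmaAlg X] = fun _ => 1 := condExp_const hXm.comap_le _
  filter_upwards [condExp_sub (integrable_const (1 : ℝ))
    ((integrable_const (1 : ℝ)).indicator (hDm (measurableSet_singleton 1))) (sigmaAlg X)]
    with ω hω
  rw [hω, Pi.sub_apply, h1]

lemma propensityWeight_mul_observed (hXm : Measurable X) (hDm : Measurable D)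
    (hD : ∀ ω, D ω = 0 ∨ D ω = 1) (h : ℝ → ℝ) :
    (fun ω => propensityWeight P D X ω * h (observed D Y ψ ω)) =ᵐ[P]
      (fun ω => inverseWeight P X (D ⁻¹' {1}) ω * h (Y ω)) -
        fun ω => inverseWeight P X (D ⁻¹' {0}) ω * h (ψ ω) := by
  -- The equality is only almost sure because `1 - p(X)` is merely a version of `P(D = 0 | X)`.
  filter_upwards [one_sub_propensity_eq (P := P) hXm hDm hD] with ω hω
  simp only [Pi.sub_apply, propensityWeight, observed, inverseWeight, Set.indicator,
    Set.mem_preimage, Set.mem_singleton_iff, hω, ← propensity_eq hD]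
  rcases hD ω with h0 | h0 <;> simp [h0]

/-- The weighted outcome `W(X) h(Ỹ)` is integrable, and its conditional mean is the difference
between the conditional means of `h(Y)` and `h(ψ)`. -/
lemma condExp_propensityWeight_mul (hYm : Measurable Y) (hψm : Measurable ψ) (hDm : Measurable D)
    (hXm : Measurable X) (hD : ∀ ω, D ω = 0 ∨ D ω = 1)
    (hoverlap : ∀ᵐ ω ∂P, 0 < propensity P D X ω ∧ propensity P D X ω < 1)
    (hCIA : CondIndepGiven P D (fun ω => (Y ω, ψ ω)) X)
    {h : ℝ → ℝ} (hh : Measurable h) (hY : Integrable (fun ω => h (Y ω)) P)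
    (hψ : Integrable (fun ω => h (ψ ω)) P) :
    Integrable (fun ω => propensityWeight P D X ω * h (observed D Y ψ ω)) P ∧
      P[fun ω => propensityWeight P D X ω * h (observed D Y ψ ω) | sigmaAlg X] =ᵐ[P]
        fun ω => ∫ s, h s ∂condDistrib Y X P (X ω) - ∫ s, h s ∂condDistrib ψ X P (X ω) := by
  have heq := propensityWeight_mul_observed (P := P) (Y := Y) (ψ := ψ) hXm hDm hD h
  have hpos1 : ∀ᵐ ω ∂P, 0 < (P⟦D ⁻¹' {1} | sigmaAlg X⟧) ω := by
    rw [← propensity_eq hD]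
    filter_upwards [hoverlap] with ω hω using hω.1
  have hpos0 : ∀ᵐ ω ∂P, 0 < (P⟦D ⁻¹' {0} | sigmaAlg X⟧) ω := by
    filter_upwards [hoverlap, one_sub_propensity_eq (P := P) hXm hDm hD] with ω hω h1
    rw [h1]
    linarith [hω.2]
  obtain ⟨i1, c1⟩ := integrable_inverseWeight_mul hXm (hYm.prodMk hψm)
    (hDm (measurableSet_singleton 1)) (fun B hB => hCIA _ B (measurableSet_singleton 1) hB) hpos1
    (hh.comp measurable_fst) hY
  obtain ⟨i0, c0⟩ := integrable_inverseWeight_mul hXm (hYm.prodMk hψm)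
    (hDm (measurableSet_singleton 0)) (fun B hB => hCIA _ B (measurableSet_singleton 0) hB) hpos0
    (hh.comp measurable_snd) hψ
  refine ⟨(i1.sub i0).congr heq.symm, (condExp_congr_ae heq).trans ?_⟩
  filter_upwards [condExp_sub i1 i0 (sigmaAlg X), c1, c0,
    condExp_ae_eq_integral_condDistrib hXm hYm.aemeasurable hh.stronglyMeasurable hY,
    condExp_ae_eq_integral_condDistrib hXm hψm.aemeasurable hh.stronglyMeasurable hψ]
    with ω h1 h2 h3 h4 h5
  rw [← h4, ← h5]
  refine h1.trans ?_
  rw [Pi.sub_apply]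
  exact congrArg₂ _ h2 h3

end Propensity

end

/-! ### From conditional convex order to rationalization and back -/

noncomputable section

section Rationalization

universe u

variable {Ω : Type u} [MeasurableSpace Ω] {P : Measure Ω} [IsProbabilityMeasure P]
  {d : ℕ} {Y ψ : Ω → ℝ} {X : Ω → Fin d → ℝ}

/-- `H0X` does not ask for integrable `Y'` and `ψ'`. Integrability is inherited because the law of
the covariates and the conditional law determine the joint law. -/
lemma integrable_of_condDistrib_eq {Ω Ω' E : Type*} [MeasurableSpace Ω] [MeasurableSpace Ω']
    [MeasurableSpace E] {P : Measure Ω} [IsFiniteMeasure P] {P' : Measure Ω'} [IsFiniteMeasure P']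
    {X : Ω → E} {X' : Ω' → E} {Y : Ω → ℝ} {Y' : Ω' → ℝ} (hX : Measurable X) (hX' : Measurable X')
    (hY : Measurable Y) (hY' : Measurable Y') (hlaw : P'.map X' = P.map X)
    (hcond : condDistrib Y' X' P' =ᵐ[P.map X] condDistrib Y X P) (hi : Integrable Y P) :
    Integrable Y' P' := by
  have h1 : P'.map (fun ω => (X' ω, Y' ω)) = P.map fun ω => (X ω, Y ω) := by
    rw [← compProd_map_condDistrib hY'.aemeasurable, ← compProd_map_condDistrib hY.aemeasurable,
      hlaw]
    exact Measure.compProd_congr hcond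
  have h2 : Integrable (fun y : E × ℝ => y.2) (P.map fun ω => (X ω, Y ω)) :=
    (integrable_map_measure (by fun_prop) (by fun_prop)).2 hi
  rw [← h1] at h2
  exact h2.comp_measurable (hX'.prodMk hY')

lemma H0X.conditional_convex_order (hYm : Measurable Y) (hψm : Measurable ψ)
    (hXm : Measurable X) (hYint : Integrable Y P) (hψint : Integrable ψ P) (h : H0X P Y ψ X) :
    (∀ y : ℝ, ∀ᵐ x ∂P.map X, ∫ s, max 0 (y - s) ∂condDistrib ψ X P x ≤
      ∫ s, max 0 (y - s) ∂condDistrib Y X P x) ∧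
    ∀ᵐ x ∂P.map X, ∫ s, s ∂condDistrib ψ X P x = ∫ s, s ∂condDistrib Y X P x := by
  obtain ⟨Ω', mΩ', P', hP', π, Y', ψ', hπ, hY'm, hψ'm, hcY, hcψ, hI⟩ := h
  have hX' : Measurable (X ∘ π) := hXm.comp hπ.measurable
  have hlaw : P'.map (X ∘ π) = P.map X := by
    rw [← Measure.map_map hXm hπ.measurable, hπ.map_eq]
  have hY'i := integrable_of_condDistrib_eq hXm hX' hYm hY'm hlaw hcY hYint
  have hψ'i := integrable_of_condDistrib_eq hXm hX' hψm hψ'm hlaw hcψ hψint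
  have ae_transfer : ∀ p : (Fin d → ℝ) → Prop, MeasurableSet {x | p x} →
      (∀ᵐ ω ∂P', p ((X ∘ π) ω)) → ∀ᵐ x ∂P.map X, p x := fun p hp hae => by
    rw [← hlaw]
    exact (ae_map_iff hX'.aemeasurable hp).2 hae
  obtain ⟨𝓘', hle, hsub, hE⟩ := hI
  have hXI : sigmaAlg (X ∘ π) ≤ 𝓘' := le_sup_right.trans hsub
  constructor
  · intro y
    have hm : StronglyMeasurable fun s : ℝ => max 0 (y - s) := by fun_prop
    have iY : Integrable (fun ω => max 0 (y - Y' ω)) P' :=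
      ((integrable_const y).sub hY'i).pos_part.congr
        (Filter.Eventually.of_forall fun ω => max_comm _ _)
    have iψ : Integrable (fun ω => max 0 (y - ψ' ω)) P' :=
      ((integrable_const y).sub hψ'i).pos_part.congr
        (Filter.Eventually.of_forall fun ω => max_comm _ _)
    -- Jensen for `s ↦ (y - s)⁺` by hand: the conditional mean dominates both `0` and `y - E[Y' |
    -- 𝓘'] = y - ψ'`.
    have jensen : (fun ω => max 0 (y - ψ' ω)) ≤ᵐ[P'] P'[fun ω => max 0 (y - Y' ω) | 𝓘'] := by
      have h1 : 0 ≤ᵐ[P'] P'[fun ω => max 0 (y - Y' ω) | 𝓘'] :=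
        condExp_nonneg (Filter.Eventually.of_forall fun ω => le_max_left _ _)
      have h2 : P'[(fun _ => y) - Y' | 𝓘'] ≤ᵐ[P'] P'[fun ω => max 0 (y - Y' ω) | 𝓘'] :=
        condExp_mono ((integrable_const y).sub hY'i) iY
          (Filter.Eventually.of_forall fun ω => le_max_right _ _)
      have h3 : P'[fun _ => y | 𝓘'] = fun _ => y := condExp_const hle y
      filter_upwards [h1, h2, condExp_sub (integrable_const y) hY'i 𝓘', hE] with ω a1 a2 a3 a4
      rw [a3, Pi.sub_apply, h3, a4] at a2
      exact max_le a1 a2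
    have hcond : P'[fun ω => max 0 (y - ψ' ω) | sigmaAlg (X ∘ π)] ≤ᵐ[P']
        P'[fun ω => max 0 (y - Y' ω) | sigmaAlg (X ∘ π)] :=
      (condExp_mono iψ integrable_condExp jensen).trans
        (condExp_condExp_of_le hXI hle).le
    have hmeas : MeasurableSet {x | ∫ s, max 0 (y - s) ∂condDistrib ψ' (X ∘ π) P' x ≤
        ∫ s, max 0 (y - s) ∂condDistrib Y' (X ∘ π) P' x} :=
      measurableSet_le hm.integral_kernel.measurable hm.integral_kernel.measurable
    have hae : ∀ᵐ x ∂P.map X, ∫ s, max 0 (y - s) ∂condDistrib ψ' (X ∘ π) P' x ≤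
        ∫ s, max 0 (y - s) ∂condDistrib Y' (X ∘ π) P' x := by
      refine ae_transfer _ hmeas ?_
      filter_upwards [hcond, condExp_ae_eq_integral_condDistrib hX' hY'm.aemeasurable hm iY,
        condExp_ae_eq_integral_condDistrib hX' hψ'm.aemeasurable hm iψ] with ω a1 a2 a3
      rwa [a2, a3] at a1
    filter_upwards [hae, hcY, hcψ] with x a1 a2 a3
    rwa [a2, a3] at a1
  · have hcond : P'[ψ' | sigmaAlg (X ∘ π)] =ᵐ[P'] P'[Y' | sigmaAlg (X ∘ π)] :=
      (condExp_congr_ae hE.symm).trans (condExp_condExp_of_le hXI hle)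
    have hm : StronglyMeasurable fun s : ℝ => s := stronglyMeasurable_id
    have hmeas : MeasurableSet {x | ∫ s, s ∂condDistrib ψ' (X ∘ π) P' x =
        ∫ s, s ∂condDistrib Y' (X ∘ π) P' x} :=
      measurableSet_eq_fun hm.integral_kernel.measurable hm.integral_kernel.measurable
    have hae : ∀ᵐ x ∂P.map X, ∫ s, s ∂condDistrib ψ' (X ∘ π) P' x =
        ∫ s, s ∂condDistrib Y' (X ∘ π) P' x := by
      refine ae_transfer _ hmeas ?_
      filter_upwards [hcond, condExp_ae_eq_integral_condDistrib' hX' hY'i,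
        condExp_ae_eq_integral_condDistrib' hX' hψ'i] with ω a1 a2 a3
      rwa [a2, a3] at a1
    filter_upwards [hae, hcY, hcψ] with x a1 a2 a3
    rwa [a2, a3] at a1

lemma map_compProd_comap {Ω E : Type*} [MeasurableSpace Ω] [MeasurableSpace E] {P : Measure Ω}
    [IsProbabilityMeasure P] {X : Ω → E} (hX : Measurable X) (κ : Kernel E ℝ) [IsMarkovKernel κ] :
    (P ⊗ₘ κ.comap X hX).map (fun y => (X y.1, y.2)) = P.map X ⊗ₘ κ := by
  refine Measure.ext_of_lintegral _ fun H hH => ?_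
  rw [lintegral_map hH (by fun_prop), Measure.lintegral_compProd (by fun_prop),
    Measure.lintegral_compProd hH, lintegral_map (by fun_prop) hX]
  rfl

lemma integrable_snd_compProd_comap (hYm : Measurable Y) (hXm : Measurable X)
    (hYint : Integrable Y P) :
    Integrable (fun y => y.2) (P ⊗ₘ (condDistrib Y X P).comap X hXm) := by
  have h1 := map_compProd_comap hXm (condDistrib Y X P) (P := P)
  rw [compProd_map_condDistrib hYm.aemeasurable] at h1
  have h2 : Integrable (fun y : (Fin d → ℝ) × ℝ => y.2) (P.map fun ω => (X ω, Y ω)) :=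
    (integrable_map_measure (by fun_prop) (by fun_prop)).2 hYint
  rw [← h1] at h2
  exact h2.comp_measurable (by fun_prop)

lemma H0X.of_conditional_convex_order (hYm : Measurable Y) (hψm : Measurable ψ)
    (hXm : Measurable X) (hYint : Integrable Y P) (hψint : Integrable ψ P)
    (hput : ∀ y : ℝ, ∀ᵐ ω ∂P, ∫ s, max 0 (y - s) ∂condDistrib ψ X P (X ω) ≤
      ∫ s, max 0 (y - s) ∂condDistrib Y X P (X ω))
    (hmean : ∀ᵐ ω ∂P, ∫ s, s ∂condDistrib ψ X P (X ω) = ∫ s, s ∂condDistrib Y X P (X ω)) :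
    H0X P Y ψ X := by
  -- The parameter space is `Ω` itself, with the kernels pulled back along `X`, so the coupling
  -- lives on an extension of `Ω` with projection `Prod.fst`. Its martingale property holds given
  -- `(ω, ψ')`, a σ-algebra containing `σ(ψ', X)`.
  obtain ⟨Q, hQ, hS, hT, hE⟩ := exists_martingale_coupling (P := P)
    ((condDistrib ψ X P).comap X hXm) ((condDistrib Y X P).comap X hXm)
    (integrable_snd_compProd_comap hψm hXm hψint) (integrable_snd_compProd_comap hYm hXm hYint)
    hmean hput
  have hfst : Q.map Prod.fst = P := by
    have : Q.map Prod.fst = (Q.map fun y => (y.1, y.2.1)).fst := by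
      rw [Measure.fst, Measure.map_map measurable_fst (by fun_prop)]
      rfl
    rw [this, hS, Measure.fst_compProd]
  have hXf : Measurable (X ∘ (Prod.fst : Ω × ℝ × ℝ → Ω)) := hXm.comp measurable_fst
  have hlaw : Q.map (X ∘ Prod.fst) = P.map X := by
    rw [← Measure.map_map hXm measurable_fst, hfst]
  refine ⟨Ω × ℝ × ℝ, inferInstance, Q, hQ, Prod.fst, fun y => y.2.2, fun y => y.2.1,
    ⟨measurable_fst, hfst⟩, by fun_prop, by fun_prop, ?_, ?_,
    sigmaAlg fun y => (y.1, y.2.1), (by fun_prop : Measurable _).comap_le, ?_, hE⟩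
  · rw [← hlaw]
    refine condDistrib_ae_eq_of_measure_eq_compProd _ (by fun_prop) ?_
    rw [hlaw, ← map_compProd_comap hXm, ← hT, Measure.map_map (by fun_prop) (by fun_prop)]
    rfl
  · rw [← hlaw]
    refine condDistrib_ae_eq_of_measure_eq_compProd _ (by fun_prop) ?_
    rw [hlaw, ← map_compProd_comap hXm, ← hS, Measure.map_map (by fun_prop) (by fun_prop)]
    rfl
  · have hc : Measurable[sigmaAlg fun y : Ω × ℝ × ℝ => (y.1, y.2.1)]
        fun y : Ω × ℝ × ℝ => (y.1, y.2.1) := comap_measurable _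
    exact sup_le (measurable_snd.comp hc).comap_le ((hXm.comp measurable_fst).comp hc).comap_le

end Rationalization

end

/-! ### The equivalence -/

theorem mainTheorem11 {Ω : Type*} [MeasurableSpace Ω] (P : Measure Ω) [IsProbabilityMeasure P]
    {d : ℕ} (Y ψ D : Ω → ℝ) (X : Ω → Fin d → ℝ)
    (hYm : Measurable Y) (hψm : Measurable ψ) (hDm : Measurable D) (hXm : Measurable X)
    (hD : ∀ ω, D ω = 0 ∨ D ω = 1)
    (hYint : Integrable Y P) (hψint : Integrable ψ P)
    (hoverlap : ∀ᵐ ω ∂P, 0 < propensity P D X ω ∧ propensity P D X ω < 1)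
    (hCIA : CondIndepGiven P D (fun ω => (Y ω, ψ ω)) X) :
    (∀ y : ℝ, Integrable (fun ω => propensityWeight P D X ω * max 0 (y - observed D Y ψ ω)) P) ∧
    Integrable (fun ω => propensityWeight P D X ω * observed D Y ψ ω) P ∧
    (H0X P Y ψ X ↔
      (∀ y : ℝ, 0 ≤ᵐ[P]
        P[fun ω => propensityWeight P D X ω * max 0 (y - observed D Y ψ ω) | sigmaAlg X]) ∧
      P[fun ω => propensityWeight P D X ω * observed D Y ψ ω | sigmaAlg X] =ᵐ[P] 0) := by
  have hput := fun y : ℝ => condExp_propensityWeight_mul hYm hψm hDm hXm hD hoverlap hCIA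
    (h := fun s => max 0 (y - s)) (by fun_prop)
    (((integrable_const y).sub hYint).pos_part.congr
      (Filter.Eventually.of_forall fun ω => max_comm _ _))
    (((integrable_const y).sub hψint).pos_part.congr
      (Filter.Eventually.of_forall fun ω => max_comm _ _))
  have hmean := condExp_propensityWeight_mul hYm hψm hDm hXm hD hoverlap hCIA
    (h := fun s => s) measurable_id hYint hψint
  refine ⟨fun y => (hput y).1, hmean.1, fun h => ?_, fun h => ?_⟩
  · obtain ⟨h1, h2⟩ := h.conditional_convex_order hYm hψm hXm hYint hψint
    refine ⟨fun y => ?_, ?_⟩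
    · filter_upwards [(hput y).2, ae_of_ae_map hXm.aemeasurable (h1 y)] with ω a1 a2
      rw [a1]
      exact sub_nonneg.2 a2
    · filter_upwards [hmean.2, ae_of_ae_map hXm.aemeasurable h2] with ω a1 a2
      rw [a1]
      exact sub_eq_zero.2 a2.symm
  · refine H0X.of_conditional_convex_order hYm hψm hXm hYint hψint (fun y => ?_) ?_
    · filter_upwards [(hput y).2, h.1 y] with ω a1 a2
      rw [a1] at a2
      exact sub_nonneg.1 a2
    · filter_upwards [hmean.2, h.2] with ω a1 a2
      rw [a1] at a2
      exact (sub_eq_zero.1 a2).symm
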